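/- Let $\xi(s)=s(s-1)\pi^{-s/2}\Gamma(s/2)\zeta(s)$ (an entire function after removal of singularities, real and positive on the real line). For real $x$ and $\tau\neq 0$ let $$F(x,\tau)=\frac1\tau\sum_{\rho}\left[1-\left(\frac{\rho}{\rho-\tau}\right)^{x}\right],$$ where $\rho$ runs over the nontrivial zeros of the Riemann zeta function, counted with multiplicity, the terms of $\rho$ and $1-\rho$ are paired together, and the powers have their principal values. For $n=1,2,\ldots$ and real $\tau$ let $$\alpha_n(\tau)=\frac{1}{(n-1)!}\,\frac{d^{n}}{ds^{n}}\Big[s^{n-1}\log \xi(s)\Big]_{s=\tau}.$$ There exist positive constants $\tau_0$ and $x_0$ such that, for all real $x,\tau$ with $\tau\ne0$ and $x_0<x<\tau_0/\tau$ (so that $\tau>0$), the paired series defining $F(x,\tau)$ converges absolutely, its sum is real, and $F(x,\tau)<0$. Moreover, there exists a constant $c>0$ such that, for every $n\ge1$, if $a_n\ge 0$ is a zero of $\alpha_n$ with $\alpha_n(\tau)<0$ for $0\le\tau<a_n$, then $a_n\ge c/n$. (So the sequence of these first zeros $a_n$, if it tends to $0$, does so no faster than $c/n$.) -/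

import Mathlib

open Complex

/-- Riemann's function `ξ(s) = s (s - 1) π ^ (-s / 2) Γ(s / 2) ζ(s)` (normalised by `ξ(0) = 1`) as an
entire function: Mathlib's `completedRiemannZeta₀` is the entire function with
`π ^ (-s / 2) Γ(s / 2) ζ(s) = completedRiemannZeta₀ s - 1 / s - 1 / (1 - s)`. -/
noncomputable def riemannXi (s : ℂ) : ℂ :=
  s * (s - 1) * completedRiemannZeta₀ s + 1

/-- The function `riemannXi` is given by the classical formula wherever all the factors of that
formula are finite. -/
theorem riemannXi_eq {s : ℂ} (h1 : s ≠ 1) (hG : ∀ n : ℕ, s / 2 ≠ -n) :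
    riemannXi s = s * (s - 1) * (Real.pi : ℂ) ^ (-s / 2) * Complex.Gamma (s / 2) * riemannZeta s := by
  have h0 : s ≠ 0 := by
    intro h
    exact hG 0 (by simp [h])
  have hpi : (Real.pi : ℂ) ^ (-s / 2) ≠ 0 := by
    simp [Complex.cpow_eq_zero_iff, Real.pi_ne_zero]
  have hΓ : Complex.Gamma (s / 2) ≠ 0 := Complex.Gamma_ne_zero hG
  have h1' : (1 : ℂ) - s ≠ 0 := sub_ne_zero.mpr (Ne.symm h1)
  rw [riemannZeta_eq_completedRiemannZeta₀ h0, riemannXi]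
  field_simp
  ring

/-- The function `riemannXi` is entire. -/
theorem differentiable_riemannXi : Differentiable ℂ riemannXi := by
  unfold riemannXi
  exact (((differentiable_id.mul (differentiable_id.sub_const 1)).mul
    differentiable_completedZeta₀).add_const 1)

/-- The set of nontrivial zeros of the Riemann zeta function (without multiplicities). -/
def nontrivialZeros : Set ℂ :=
  {ρ | riemannZeta ρ = 0 ∧ 0 < ρ.re ∧ ρ.re < 1}

/-- The term `1 - (ρ / (ρ - τ)) ^ x`, with the principal value of the power. -/
noncomputable def liTerm (x τ : ℝ) (ρ : ℂ) : ℂ :=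
  1 - (ρ / (ρ - (τ : ℂ))) ^ (x : ℂ)

/-- The terms belonging to `ρ` and `1 - ρ`, paired together and counted with the multiplicity
of the zero. -/
noncomputable def liPairedTerm (x τ : ℝ) (ρ : nontrivialZeros) : ℂ :=
  (analyticOrderNatAt riemannZeta (ρ : ℂ) : ℂ) * (liTerm x τ ρ + liTerm x τ (1 - ρ))

/-- The number `(1 / τ) ∑_ρ [1 - (ρ / (ρ - τ)) ^ x]`, where `ρ` runs over the nontrivial zeros of
zeta with multiplicity and the terms of `ρ` and `1 - ρ` are paired. In the series below each
pair `{ρ, 1 - ρ}` occurs twice, once for each of its members, whence the factor `1 / 2`. -/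
noncomputable def liSum (x τ : ℝ) : ℂ :=
  1 / (τ : ℂ) * (1 / 2 * ∑' ρ : nontrivialZeros, liPairedTerm x τ ρ)

/-- The function `F` on `ℝ × ℝ` as a real-valued function. -/
noncomputable def liF (x τ : ℝ) : ℝ := (liSum x τ).re

/-- The coefficient `α_n(τ) = 1 / (n - 1)! * (d / ds) ^ n [s ^ (n - 1) log ξ(s)]` at `s = τ`, for
`n ≥ 1` and real `τ`; the function `ξ` is real and positive on the real line. -/
noncomputable def liAlpha (n : ℕ) (τ : ℝ) : ℝ :=
  1 / ((n - 1).factorial : ℝ) *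
    iteratedDeriv n (fun s : ℝ => s ^ (n - 1) * Real.log (riemannXi (s : ℂ)).re) τ

/-- `a` is the zero of `α_n` on `[0, ∞)` to the left of which `α_n` is negative. -/
def IsFirstZeroLiAlpha (n : ℕ) (a : ℝ) : Prop :=
  0 ≤ a ∧ liAlpha n a = 0 ∧ ∀ τ : ℝ, 0 ≤ τ → τ < a → liAlpha n τ < 0

/-! Write `y = x * τ`. For small `y` each term expands as `1 - (ρ / (ρ - τ)) ^ x = -y / ρ + O(y ^ 2
/ ‖ρ‖ ^ 2)` (`norm_liTerm_add_le`), so the paired sum is `-y * ∑ m(ρ) (1 / ρ + 1 / (1 - ρ)) + O(y ^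
2 * ∑ m(ρ) / ‖ρ‖ ^ 2)`. Every summand of the linear coefficient has positive real part because `0 <
re ρ < 1`, so `F < 0` once two facts are known. The series `∑ m(ρ) / ‖ρ‖ ^ 2` converges, by Jensen's
bound and the growth of `ξ` (`exists_norm_riemannXi_le`). And there is at least one zero: otherwise
`ξ = exp h` with `h` affine, the symmetry `s ↦ 1 - s` makes `ξ` constant, and this contradicts
`ξ'(0) < 0` (`deriv_riemannXi_zero_re_neg`).

For the second claim, `α_n(τ) / n` is the `n`-th Taylor coefficient of `s ^ (n - 1) * log ξ(s)` at
`τ`, that is, the Cauchy integral of `(s / (s - τ)) ^ (n - 1) * log ξ(s) / (s - τ) ^ 2`. When `n *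
τ` is small the power is close to `1`, so the coefficient is close to `(log ξ)'(τ)`, hence to `ξ'(0)
< 0`. -/

/-! ### Counting zeros of entire functions -/

open MeromorphicOn in
/-- A bound for the number of zeros, with multiplicity, of an entire function in a disc. -/
theorem sum_analyticOrderNatAt_le {f : ℂ → ℂ} (hf : Differentiable ℂ f) (h0 : f 0 ≠ 0)
    {r M : ℝ} (hr : 0 < r) (hM : 1 ≤ M) (hb : ∀ z, ‖z‖ = 2 * r → ‖f z‖ ≤ M)
    (F : Finset ℂ) (hF : ∀ u ∈ F, ‖u‖ ≤ r) :
    ∑ u ∈ F, (analyticOrderNatAt f u : ℝ) ≤ Real.log (M / ‖f 0‖) / Real.log 2 := by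
  have han : ∀ s : Set ℂ, AnalyticOnNhd ℂ f s := fun s z _ => hf.analyticAt z
  have habs : |r| = r := abs_of_pos hr
  have habs2 : |2 * r| = 2 * r := abs_of_pos (by positivity)
  -- Jensen's inequality; the ratio `2` of the two radii produces the `log 2`.
  have key := AnalyticOnNhd.sum_divisor_le (c := 0) (r := r) (R := 2 * r) (M := M) (f := f)
    (by simpa using hr.ne') (by rw [habs, habs2]; linarith) hM (han _) h0
    (fun z hz => hb z (by simpa [habs2, abs_of_pos hr] using hz))
  rw [mul_div_assoc, div_self hr.ne', mul_one] at key
  refine le_trans ?_ key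
  have hfin := (divisor f (Metric.closedBall 0 |r|)).finiteSupport
    (isCompact_closedBall 0 |r|)
  have hval : ∀ u ∈ F, (analyticOrderNatAt f u : ℤ) = divisor f (Metric.closedBall 0 |r|) u := by
    intro u hu
    rw [AnalyticOnNhd.divisor_apply (han _) (by simpa [habs] using hF u hu)]
    unfold analyticOrderNatAt
    cases analyticOrderAt f u <;> rfl
  rw [finsum_eq_sum_of_support_subset _ (s := hfin.toFinset) (by simp)]
  have : (∑ u ∈ F, (analyticOrderNatAt f u : ℤ)) ≤
      ∑ u ∈ hfin.toFinset, divisor f (Metric.closedBall 0 |r|) u := by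
    rw [Finset.sum_congr rfl hval]
    rw [← Finset.sum_filter_ne_zero]
    refine Finset.sum_le_sum_of_subset_of_nonneg (fun u hu => ?_)
      fun u _ _ => (han _).divisor_nonneg u
    simpa using (Finset.mem_filter.mp hu).2
  exact_mod_cast this

/-- Sorts points into dyadic shells, on which the weight `1 / ‖u‖ ^ 2` decays like `4 ^ (-k)`. The
term `1 / δ ^ 2` pays for the points of the unit disc, which all go to `k = 0`. -/
theorem exists_norm_le_two_pow {δ : ℝ} (hδ : 0 < δ) (u : ℂ) :
    ∃ k : ℕ, ‖u‖ ≤ 2 ^ k ∧ (δ ≤ ‖u‖ → 1 / ‖u‖ ^ 2 ≤ (4 + 1 / δ ^ 2) * (1 / 4) ^ k) := by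
  rcases lt_or_ge ‖u‖ 1 with h | h
  · refine ⟨0, by simpa using h.le, fun h' => ?_⟩
    have : 1 / ‖u‖ ^ 2 ≤ 1 / δ ^ 2 := by gcongr
    simp only [pow_zero, mul_one]
    linarith
  · obtain ⟨n, h1, h2⟩ := exists_nat_pow_near h (one_lt_two : (1 : ℝ) < 2)
    refine ⟨n + 1, h2.le, fun _ => ?_⟩
    have h3 : 1 / ‖u‖ ^ 2 ≤ 1 / ((2 : ℝ) ^ n) ^ 2 := by gcongr
    have h4 : 1 / ((2 : ℝ) ^ n) ^ 2 = 4 * (1 / 4) ^ (n + 1) := by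
      rw [← pow_mul, mul_comm n 2, pow_mul, pow_succ, one_div_pow]; norm_num; ring
    have : 0 ≤ 1 / δ ^ 2 * (1 / 4 : ℝ) ^ (n + 1) := by positivity
    linarith

/-- The series of the `m(ρ) / ‖ρ‖ ^ 2` over the zeros `ρ` of an entire function of order at most
`3 / 2` (in the strong sense) converges. -/
theorem summable_analyticOrderNatAt_div_norm_sq {f : ℂ → ℂ} (hf : Differentiable ℂ f)
    (h0 : f 0 ≠ 0) {A : ℝ} (hA : 0 ≤ A)
    (hg : ∀ z, ‖f z‖ ≤ Real.exp (A * (1 + ‖z‖) ^ (3 / 2 : ℝ))) :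
    Summable fun u : ℂ => (analyticOrderNatAt f u : ℝ) / ‖u‖ ^ 2 := by
  obtain ⟨δ, hδ, hball⟩ := Metric.eventually_nhds_iff.mp
    ((hf.continuous.continuousAt (x := 0)).eventually_ne h0)
  choose k hk1 hk2 using exists_norm_le_two_pow hδ
  set K : ℝ := 4 + 1 / δ ^ 2
  have hK : 0 ≤ K := by positivity
  -- Shell `j` holds `O(q ^ j)` zeros of weight `O(4 ^ (-j))`; the sum converges because `3 / 2 <
  -- 2`.
  set q : ℝ := 2 ^ (3 / 2 : ℝ) with hq
  have hq0 : 0 < q := by positivity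
  have hq4 : q < 4 := by
    have : q < 2 ^ (2 : ℝ) := Real.rpow_lt_rpow_of_exponent_lt one_lt_two (by norm_num)
    norm_num at this
    exact this
  set B : ℝ := |Real.log ‖f 0‖|
  let g : ℕ → ℝ := fun j => K * ((8 * A) * (q / 4) ^ j + B * (1 / 4) ^ j) / Real.log 2
  have hlog2 : 0 < Real.log 2 := Real.log_pos one_lt_two
  have hgs : Summable g := by
    have s1 : Summable fun j : ℕ => (q / 4) ^ j :=
      summable_geometric_of_lt_one (by positivity) (by rw [div_lt_one] <;> linarith)
    have s2 : Summable fun j : ℕ => (1 / 4 : ℝ) ^ j :=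
      summable_geometric_of_lt_one (by positivity) (by norm_num)
    exact (((s1.mul_left (8 * A)).add (s2.mul_left B)).mul_left K).div_const (Real.log 2)
  have hg0 : ∀ j, 0 ≤ g j := fun j => by positivity
  refine summable_of_sum_le (c := ∑' j, g j) (fun u => by positivity) fun F => ?_
  have hcount : ∀ j : ℕ, ∑ u ∈ F with k u = j, (analyticOrderNatAt f u : ℝ) ≤
      (8 * A * q ^ j + B) / Real.log 2 := by
    intro j
    refine (sum_analyticOrderNatAt_le hf h0 (r := 2 ^ j)
      (M := Real.exp (A * (8 * q ^ j))) (by positivity)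
      (Real.one_le_exp (by positivity)) ?_ _ ?_).trans ?_
    · intro z hz
      refine (hg z).trans (Real.exp_le_exp.mpr (mul_le_mul_of_nonneg_left ?_ hA))
      have h1 : (1 : ℝ) ≤ 2 ^ j := one_le_pow₀ one_le_two
      have h2 : 1 + ‖z‖ ≤ 2 ^ (2 : ℝ) * 2 ^ j := by rw [hz]; norm_num; linarith
      calc (1 + ‖z‖) ^ (3 / 2 : ℝ) ≤ (2 ^ (2 : ℝ) * 2 ^ j) ^ (3 / 2 : ℝ) := by gcongr
        _ = 8 * q ^ j := by
          rw [Real.mul_rpow (by positivity) (by positivity), ← Real.rpow_mul (by norm_num), hq,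
            ← Real.rpow_natCast, ← Real.rpow_natCast, ← Real.rpow_mul (by norm_num),
            ← Real.rpow_mul (by norm_num), mul_comm (j : ℝ)]
          norm_num
    · intro u hu
      rw [← (Finset.mem_filter.mp hu).2]
      exact hk1 u
    · rw [Real.log_div (Real.exp_pos _).ne' (by simpa using h0), Real.log_exp]
      gcongr
      have : -Real.log ‖f 0‖ ≤ B := neg_le_abs _
      linarith
  rw [← Finset.sum_fiberwise_of_maps_to (t := F.image k)
    (fun u hu => Finset.mem_image_of_mem k hu)]
  refine le_trans (Finset.sum_le_sum fun j _ => ?_) (hgs.sum_le_tsum _ fun j _ => hg0 j)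
  calc ∑ u ∈ F with k u = j, (analyticOrderNatAt f u : ℝ) / ‖u‖ ^ 2
      ≤ ∑ u ∈ F with k u = j, (K * (1 / 4) ^ j) * (analyticOrderNatAt f u : ℝ) := by
        refine Finset.sum_le_sum fun u hu => ?_
        rcases eq_or_ne (analyticOrderNatAt f u) 0 with hz | hz
        · simp [hz]
        · have hu0 : f u = 0 := apply_eq_zero_of_analyticOrderNatAt_ne_zero hz
          have : δ ≤ ‖u‖ := by
            by_contra! hlt
            exact hball (by simpa using hlt) hu0
          have := hk2 u this
          rw [(Finset.mem_filter.mp hu).2] at this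
          rw [div_eq_mul_one_div, mul_comm]
          gcongr
    _ = (K * (1 / 4) ^ j) * ∑ u ∈ F with k u = j, (analyticOrderNatAt f u : ℝ) := by
        rw [Finset.mul_sum]
    _ ≤ (K * (1 / 4) ^ j) * ((8 * A * q ^ j + B) / Real.log 2) := by
        gcongr
        exact hcount j
    _ = g j := by
        simp only [g, div_pow]
        ring

/-! ### Zero-free entire functions of order below two -/

/-- A zero-free entire function has an entire logarithm. -/
theorem exists_differentiable_exp_eq {f : ℂ → ℂ} (hf : Differentiable ℂ f) (h0 : ∀ z, f z ≠ 0) :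
    ∃ h : ℂ → ℂ, Differentiable ℂ h ∧ ∀ z, f z = exp (h z) := by
  have hd : Differentiable ℂ (fun z => deriv f z / f z) := hf.deriv.div hf h0
  obtain ⟨g, hg0, hg⟩ := hd.isExactOn_univ.with_val_at 0 (log (f 0))
  have hgd : Differentiable ℂ g := fun z => (hg z trivial).differentiableAt
  refine ⟨g, hgd, fun z => ?_⟩
  have hc : Differentiable ℂ fun z => f z * exp (-g z) := by fun_prop
  have := is_const_of_deriv_eq_zero hc (fun w => ?_) z 0
  · simp only [hg0, exp_neg, exp_log (h0 0)] at this
    rw [mul_inv_cancel₀ (h0 0)] at this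
    field_simp at this
    exact this
  · have h1 := ((hf w).hasDerivAt).mul ((hg w trivial).neg.cexp)
    refine h1.deriv.trans ?_
    field_simp [h0 w]
    simp

/-- A zero-free entire function of order less than `2` which is symmetric about a point is
stationary. -/
theorem deriv_eq_zero_of_ne_zero_of_symm {f : ℂ → ℂ} (hf : Differentiable ℂ f)
    (h0 : ∀ z, f z ≠ 0) (hsymm : ∀ z, f (1 - z) = f z) {A : ℝ} (hA : 0 ≤ A)
    (hg : ∀ z, ‖f z‖ ≤ Real.exp (A * (1 + ‖z‖) ^ (3 / 2 : ℝ))) (z : ℂ) : deriv f z = 0 := by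
  obtain ⟨h, hh, hfh⟩ := exists_differentiable_exp_eq hf h0
  have hre : ∀ z, (h z).re ≤ A * (1 + ‖z‖) ^ (3 / 2 : ℝ) := fun z => by
    have := hg z
    rwa [hfh, norm_exp, Real.exp_le_exp] at this
  have hd2 : ∀ c, iteratedDeriv 2 h c = 0 := by
    intro c
    obtain ⟨H, hH⟩ : ∃ H, H = ‖h 0‖ := ⟨_, rfl⟩
    -- Borel–Carathéodory on `‖w‖ ≤ R / 2` bounds `‖h w‖` by the bracket: there `‖w‖ ≤ R - ‖w‖` and
    -- `R + ‖w‖ ≤ 3 * (R - ‖w‖)`. Cauchy's estimate on a circle of radius `R / 4` then gives `b R =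
    -- O(R ^ (-1 / 2))`. Using `A + 1` keeps the bound on `re h` strictly positive.
    let b : ℝ → ℝ := fun R => 2 * (2 * (A + 1) * (2 * R ) ^ (3 / 2 : ℝ) + 3 * H) / (R / 4) ^ 2
    have hbd : ∀ᶠ R : ℝ in Filter.atTop, ‖iteratedDeriv 2 h c‖ ≤ b R := by
      filter_upwards [Filter.eventually_ge_atTop (1 : ℝ),
        Filter.eventually_ge_atTop (4 * ‖c‖)] with R hR1 hRc
      have hR : 0 < R := by linarith
      have := norm_iteratedDeriv_le_of_forall_mem_sphere_norm_le (c := c) (R := R / 4)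
        (C := 2 * (A + 1) * (2 * R ) ^ (3 / 2 : ℝ) + 3 * H) 2 (by positivity)
        hh.diffContOnCl (f := h) ?_
      · simpa using this
      intro w hw
      have hwn : ‖w‖ ≤ R / 2 := by
        have h1 : ‖w - c‖ = R / 4 := by simpa [dist_eq_norm] using hw
        have h2 : ‖w‖ ≤ ‖w - c‖ + ‖c‖ := by simpa using norm_add_le (w - c) c
        linarith
      have hM : 0 < (A + 1) * (2 * R) ^ (3 / 2 : ℝ) := by positivity
      have bc := borelCaratheodory (f := h) (R := R) hM hh.differentiableOn (fun v hv => ?_) hR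
        (z := w) (by simp; linarith)
      · refine bc.trans (add_le_add ?_ ?_)
        · rw [div_le_iff₀ (by linarith)]
          have : ‖w‖ ≤ R - ‖w‖ := by linarith
          calc _ ≤ 2 * ((A + 1) * (2 * R) ^ (3 / 2 : ℝ)) * (R - ‖w‖) := by gcongr
            _ = _ := by ring
        · rw [← hH, div_le_iff₀ (by linarith)]
          have hH0 : 0 ≤ H := hH ▸ norm_nonneg _
          nlinarith
      · have hv' : ‖v‖ < R := by simpa using hv
        refine (hre v).trans ?_
        gcongr <;> linarith
    have hlim : Filter.Tendsto b Filter.atTop (nhds 0) := by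
      have e1 : Filter.Tendsto (fun R : ℝ => 64 * (A + 1) * 2 ^ (3 / 2 : ℝ) * R ^ (-(1 / 2) : ℝ)
          + 96 * H * R ^ (-2 : ℝ)) Filter.atTop (nhds (64 * (A + 1) * 2 ^ (3 / 2 : ℝ) * 0 +
            96 * H * 0)) :=
        ((tendsto_rpow_neg_atTop (by norm_num)).const_mul _).add
          ((tendsto_rpow_neg_atTop (by norm_num)).const_mul _)
      simp only [mul_zero, add_zero] at e1
      refine e1.congr' ?_
      filter_upwards [Filter.eventually_gt_atTop (0 : ℝ)] with R hR
      have e2 : R ^ (-(1 / 2) : ℝ) = R ^ (3 / 2 : ℝ) / R ^ 2 := by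
        rw [← Real.rpow_natCast, ← Real.rpow_sub hR]; norm_num
      have e3 : R ^ (-2 : ℝ) = 1 / R ^ 2 := by
        rw [Real.rpow_neg hR.le, one_div]; norm_num
      simp only [b]
      rw [e2, e3, Real.mul_rpow (by norm_num) hR.le]
      field_simp
      ring
    have := ge_of_tendsto hlim hbd
    exact norm_le_zero_iff.mp this
  have hconst : ∀ z w, deriv h z = deriv h w := by
    refine is_const_of_deriv_eq_zero hh.deriv fun c => ?_
    have := hd2 c
    rwa [iteratedDeriv_succ, iteratedDeriv_one] at this
  have hlog : ∀ w, deriv f w = deriv h w * f w := by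
    intro w
    have : f = fun z => exp (h z) := funext hfh
    rw [this]
    rw [((hh w).hasDerivAt.cexp).deriv, mul_comm]
  -- The symmetry makes `f'` odd about `1 / 2`, while `f' = κ * f` with `κ` constant makes it even.
  have hs : deriv f (1 - z) = - deriv f z := by
    have h1 : HasDerivAt (fun z => f (1 - z)) (-deriv f (1 - z)) z :=
      (hf (1 - z)).hasDerivAt.comp_const_sub 1 z
    rw [funext hsymm] at h1
    rw [h1.deriv, neg_neg]
  have h2 := hlog z
  have h3 := hlog (1 - z)
  rw [hs, hsymm, hconst (1 - z) z, ← h2] at h3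
  linear_combination (-1 / 2) * h3

/-! ### Growth of `ξ` -/

/-- The Mellin transform of an exponentially decaying function grows at most like `n ^ n` in the
strips `0 ≤ re s ≤ n`. -/
theorem exists_norm_mellin_le {φ : ℝ → ℂ} (hφ : ∀ s, MellinConvergent φ s) {p : ℝ} (hp : 0 < p)
    (hO : φ =O[Filter.atTop] fun t => Real.exp (-p * t)) :
    ∃ D b : ℝ, 0 ≤ D ∧ 1 ≤ b ∧ ∀ n : ℕ, 1 ≤ n → ∀ s : ℂ, 0 ≤ s.re → s.re ≤ n →
      ‖mellin φ s‖ ≤ D * b ^ n * (n : ℝ) ^ n := by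
  obtain ⟨C, hC0, hC⟩ := hO.exists_pos
  obtain ⟨T₀, hT₀⟩ := Filter.eventually_atTop.mp hC.bound
  set T := max T₀ 1
  have hT1 : 1 ≤ T := le_max_right _ _
  have hTC : ∀ t, T ≤ t → ‖φ t‖ ≤ C * Real.exp (-p * t) := fun t ht => by
    simpa using hT₀ t ((le_max_left _ _).trans ht)
  have hnorm : ∀ (s : ℂ), ∀ t ∈ Set.Ioi (0 : ℝ),
      ‖(t : ℂ) ^ (s - 1) • φ t‖ = t ^ (s.re - 1) * ‖φ t‖ := fun s t ht => by
    rw [norm_smul, norm_cpow_eq_rpow_re_of_pos ht]; simp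
  have hint : ∀ s : ℂ, MeasureTheory.IntegrableOn (fun t : ℝ => t ^ (s.re - 1) * ‖φ t‖)
      (Set.Ioi 0) := fun s =>
    (MeasureTheory.integrableOn_congr_fun (hnorm s) measurableSet_Ioi).mp (hφ s).norm
  set J := ∫ t in Set.Ioi (0 : ℝ), t ^ ((0 : ℂ).re - 1) * ‖φ t‖ with hJ
  have hJ0 : 0 ≤ J := MeasureTheory.setIntegral_nonneg measurableSet_Ioi fun t ht =>
    mul_nonneg (Real.rpow_nonneg (le_of_lt ht) _) (norm_nonneg _)
  set b := max T (1 / p)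
  have hb1 : 1 ≤ b := hT1.trans (le_max_left _ _)
  refine ⟨J + C, b, by positivity, hb1, fun n hn s hs0 hsn => ?_⟩
  have hn0 : (0 : ℝ) < n := by exact_mod_cast hn
  have hgam : MeasureTheory.IntegrableOn (fun t : ℝ => t ^ ((n : ℝ) - 1) * Real.exp (-(p * t)))
      (Set.Ioi 0) := by
    have := integrableOn_rpow_mul_exp_neg_mul_rpow (p := 1) (s := (n : ℝ) - 1) (b := p)
      (by linarith) one_pos hp
    simpa using this
  -- Below `T` the integrand is compared with the one at `s = 0`, at the cost of `T ^ n`; above `T`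
  -- the exponential decay leaves a Gamma integral.
  have hle : ‖mellin φ s‖ ≤ ∫ t in Set.Ioi (0 : ℝ),
      (T ^ n * (t ^ ((0 : ℂ).re - 1) * ‖φ t‖) + C * (t ^ ((n : ℝ) - 1) * Real.exp (-(p * t)))) := by
    refine (MeasureTheory.norm_integral_le_integral_norm _).trans ?_
    refine MeasureTheory.setIntegral_mono_on (hφ s).norm
      (((hint 0).const_mul _).add (hgam.const_mul _)) measurableSet_Ioi fun t ht => ?_
    have ht0 : (0 : ℝ) < t := ht
    rw [hnorm s t ht]
    rcases le_total t T with h | h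
    · refine le_add_of_le_of_nonneg ?_ (by positivity)
      rw [← mul_assoc]
      gcongr
      rw [Real.rpow_sub ht0, Real.rpow_sub ht0, Real.rpow_one, mul_div_assoc']
      gcongr
      simp only [zero_re, Real.rpow_zero, mul_one]
      calc t ^ s.re ≤ T ^ s.re := by gcongr
        _ ≤ T ^ (n : ℝ) := by gcongr
        _ = T ^ n := Real.rpow_natCast _ _
    · refine le_add_of_nonneg_of_le (by positivity) ?_
      have h1 : t ^ (s.re - 1) ≤ t ^ ((n : ℝ) - 1) := by gcongr; exact hT1.trans h
      calc t ^ (s.re - 1) * ‖φ t‖ ≤ t ^ ((n : ℝ) - 1) * (C * Real.exp (-p * t)) := by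
            gcongr; exact hTC t h
        _ = _ := by rw [neg_mul]; ring
  rw [MeasureTheory.integral_add ((hint 0).const_mul _) (hgam.const_mul _),
    MeasureTheory.integral_const_mul, MeasureTheory.integral_const_mul,
    Real.integral_rpow_mul_exp_neg_mul_Ioi hn0 hp, ← hJ, Real.rpow_natCast] at hle
  have hGam : Real.Gamma n ≤ (n : ℝ) ^ n := by
    obtain ⟨m, rfl⟩ : ∃ m, n = m + 1 := ⟨n - 1, by omega⟩
    push_cast
    rw [Real.Gamma_nat_eq_factorial]
    exact_mod_cast (Nat.factorial_le (Nat.le_succ m)).trans (Nat.factorial_le_pow (m + 1))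
  have hnn : (1 : ℝ) ≤ (n : ℝ) ^ n := one_le_pow₀ (by exact_mod_cast hn)
  have hTb : T ^ n ≤ b ^ n := by gcongr; exact le_max_left _ _
  have hpb : (1 / p) ^ n ≤ b ^ n := by gcongr; exact le_max_right _ _
  calc ‖mellin φ s‖ ≤ T ^ n * J + C * ((1 / p) ^ n * Real.Gamma n) := hle
    _ ≤ b ^ n * J + C * (b ^ n * (n : ℝ) ^ n) := by
      gcongr
    _ ≤ b ^ n * J * (n : ℝ) ^ n + C * (b ^ n * (n : ℝ) ^ n) := by
      exact add_le_add_left (le_mul_of_one_le_right (by positivity) hnn) _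
    _ = _ := by ring

/-- `completedRiemannZeta₀ s` is half the Mellin transform at `s / 2` of a modified theta kernel,
which for `t > 1` is the kernel minus its constant term and so decays exponentially. -/
theorem exists_norm_completedRiemannZeta₀_le :
    ∃ D b : ℝ, 0 ≤ D ∧ 1 ≤ b ∧ ∀ n : ℕ, 1 ≤ n → ∀ s : ℂ, 0 ≤ s.re → s.re ≤ n →
      ‖completedRiemannZeta₀ s‖ ≤ D * b ^ n * (n : ℝ) ^ n := by
  let P := HurwitzZeta.hurwitzEvenFEPair 0
  have hstrong := P.isStrongFEPair_toStrongFEPair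
  obtain ⟨p, hp, hpO⟩ := HurwitzZeta.isBigO_atTop_evenKernel_sub 0
  obtain ⟨D, b, hD, hb, h⟩ := exists_norm_mellin_le (φ := P.f_modif)
    (fun s => (hstrong.hasMellin s).1) hp (by
      refine Asymptotics.IsBigO.congr' (isBigO_ofReal_left.mpr hpO) ?_ .rfl
      filter_upwards [Filter.eventually_gt_atTop 1] with t ht
      simp [P, WeakFEPair.f_modif, ht, ht.le, HurwitzZeta.hurwitzEvenFEPair])
  refine ⟨D, b, hD, hb, fun n hn s hs0 hsn => ?_⟩
  have hre : (s / 2).re = s.re / 2 := by simp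
  have := h n hn (s / 2) (by rw [hre]; linarith) (by rw [hre]; linarith)
  have e : completedRiemannZeta₀ s = mellin P.f_modif (s / 2) / 2 := rfl
  rw [e, norm_div]
  norm_num
  linarith [norm_nonneg (mellin P.f_modif (s / 2))]

theorem riemannXi_one_sub (s : ℂ) : riemannXi (1 - s) = riemannXi s := by
  simp only [riemannXi, completedRiemannZeta₀_one_sub]
  ring

/-- Riemann's `ξ` is of order at most `3 / 2` (in fact, of order `1`). -/
theorem exists_norm_riemannXi_le :
    ∃ A : ℝ, 0 ≤ A ∧ ∀ z, ‖riemannXi z‖ ≤ Real.exp (A * (1 + ‖z‖) ^ (3 / 2 : ℝ)) := by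
  obtain ⟨D, b, hD, hb, h⟩ := exists_norm_completedRiemannZeta₀_le
  have hlb : 0 ≤ Real.log b := Real.log_nonneg hb
  -- `11 = 2 + 8 + 1`: from the two linear factors, from `n * log n`, and from absorbing the summand
  -- `1` of `ξ`.
  set A : ℝ := 11 + D + 2 * Real.log b with hA
  have hA0 : 0 ≤ A := by positivity
  have key : ∀ z : ℂ, 0 ≤ z.re → ‖riemannXi z‖ ≤ Real.exp (A * (1 + ‖z‖) ^ (3 / 2 : ℝ)) := by
    intro z hz
    set y := 1 + ‖z‖ with hy
    have hy1 : 1 ≤ y := by linarith [norm_nonneg z]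
    set n := ⌈‖z‖⌉₊ + 1 with hn
    have hn1 : 1 ≤ n := by omega
    have hnz : ‖z‖ ≤ n := by
      have := Nat.le_ceil ‖z‖
      rw [hn]; push_cast; linarith
    have hny : (n : ℝ) ≤ 2 * y := by
      have := (Nat.ceil_lt_add_one (norm_nonneg z)).le
      rw [hn]; push_cast; linarith
    have hn0 : (0 : ℝ) < n := by exact_mod_cast hn1
    have hyp : y ^ (3 / 2 : ℝ) = y * √y := by
      rw [Real.sqrt_eq_rpow, ← Real.rpow_one_add' (by linarith) (by norm_num)]; norm_num
    have hsq1 : 1 ≤ √y := Real.one_le_sqrt.mpr hy1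
    have hyy : y ≤ y ^ (3 / 2 : ℝ) := by
      rw [hyp]; exact le_mul_of_one_le_right (by linarith) hsq1
    -- Bounding the logarithm by a square root turns `n ^ n` into `exp (O(y ^ (3 / 2)))`.
    have hlogn : Real.log n ≤ 4 * √y := by
      have h1 : Real.log n = 2 * Real.log √n := by rw [Real.log_sqrt hn0.le]; ring
      have h2 : Real.log √n ≤ √n := Real.log_le_self (Real.sqrt_nonneg _)
      have h3 : √n ≤ 2 * √y := by
        rw [Real.sqrt_le_left (by positivity), mul_pow, Real.sq_sqrt (by linarith)]
        linarith
      linarith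
    have hnlog : n * Real.log n ≤ 8 * y ^ (3 / 2 : ℝ) := by
      calc n * Real.log n ≤ (2 * y) * (4 * √y) :=
            mul_le_mul hny hlogn (Real.log_natCast_nonneg n) (by linarith)
        _ = 8 * y ^ (3 / 2 : ℝ) := by rw [hyp]; ring
    have hbn : b ^ n * (n : ℝ) ^ n = Real.exp (n * Real.log b + n * Real.log n) := by
      rw [Real.exp_add, Real.exp_nat_mul, Real.exp_nat_mul, Real.exp_log (by linarith),
        Real.exp_log hn0]
    have hprod : ‖z * (z - 1) * completedRiemannZeta₀ z‖ ≤
        Real.exp (2 * y + D + 2 * y * Real.log b + 8 * y ^ (3 / 2 : ℝ)) := by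
      have h1 : ‖z‖ ≤ Real.exp y := by linarith [Real.add_one_le_exp y]
      have h2 : ‖z - 1‖ ≤ Real.exp y := by
        have := norm_sub_le z 1
        rw [norm_one] at this
        linarith [Real.add_one_le_exp y]
      have h3 : ‖completedRiemannZeta₀ z‖ ≤
          Real.exp D * Real.exp (2 * y * Real.log b + 8 * y ^ (3 / 2 : ℝ)) := by
        refine (h n hn1 z hz ((re_le_norm z).trans hnz)).trans ?_
        rw [mul_assoc, hbn]
        gcongr
        linarith [Real.add_one_le_exp D]
      rw [norm_mul, norm_mul]
      calc _ ≤ Real.exp y * Real.exp y *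
            (Real.exp D * Real.exp (2 * y * Real.log b + 8 * y ^ (3 / 2 : ℝ))) := by gcongr
        _ = _ := by rw [← Real.exp_add, ← Real.exp_add, ← Real.exp_add]; ring_nf
    set u := 2 * y + D + 2 * y * Real.log b + 8 * y ^ (3 / 2 : ℝ) with hu
    have hu0 : 0 ≤ u := by positivity
    calc ‖riemannXi z‖ ≤ Real.exp u + 1 := by
          refine (norm_add_le _ _).trans ?_
          rw [norm_one]
          exact add_le_add_left hprod 1
      _ ≤ Real.exp (u + 1) := by
          rw [Real.exp_add u 1]
          have h1 : 2 ≤ Real.exp 1 := by linarith [Real.add_one_le_exp 1]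
          nlinarith only [Real.one_le_exp hu0, h1]
      _ ≤ _ := by
          apply Real.exp_le_exp.mpr
          have h1 : 1 ≤ y ^ (3 / 2 : ℝ) := hy1.trans hyy
          have h2 : D ≤ D * y ^ (3 / 2 : ℝ) := le_mul_of_one_le_right hD h1
          have h3 : y * Real.log b ≤ y ^ (3 / 2 : ℝ) * Real.log b := by gcongr
          rw [hu, hA]
          linarith
  -- The functional equation covers `re z ≤ 0`; the `4` bounds `2 ^ (3 / 2)`, since `1 + ‖1 - z‖ ≤ 2
  -- * (1 + ‖z‖)`.
  refine ⟨4 * A, by positivity, fun z => ?_⟩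
  rcases le_total 0 z.re with hz | hz
  · refine (key z hz).trans (Real.exp_le_exp.mpr ?_)
    have : 0 ≤ A * (1 + ‖z‖) ^ (3 / 2 : ℝ) := by positivity
    linarith
  · rw [← riemannXi_one_sub]
    refine (key (1 - z) (by simp; linarith)).trans (Real.exp_le_exp.mpr ?_)
    have h1 : 1 + ‖1 - z‖ ≤ 2 * (1 + ‖z‖) := by
      have := norm_sub_le 1 z
      rw [norm_one] at this
      linarith [norm_nonneg z]
    have h2 : (2 : ℝ) ^ (3 / 2 : ℝ) ≤ 4 := by
      have : (2 : ℝ) ^ (3 / 2 : ℝ) ≤ 2 ^ (2 : ℝ) :=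
        Real.rpow_le_rpow_of_exponent_le one_le_two (by norm_num)
      norm_num at this ⊢
      exact this
    calc A * (1 + ‖1 - z‖) ^ (3 / 2 : ℝ) ≤ A * (2 * (1 + ‖z‖)) ^ (3 / 2 : ℝ) := by gcongr
      _ = A * (2 ^ (3 / 2 : ℝ) * (1 + ‖z‖) ^ (3 / 2 : ℝ)) := by
        rw [Real.mul_rpow (by norm_num) (by positivity)]
      _ ≤ A * (4 * (1 + ‖z‖) ^ (3 / 2 : ℝ)) := by gcongr
      _ = _ := by ring

/-! ### `ξ` near the origin -/

theorem riemannXi_zero : riemannXi 0 = 1 := by simp [riemannXi]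

theorem deriv_riemannXi_zero : deriv riemannXi 0 = -completedRiemannZeta₀ 0 := by
  have h := ((((hasDerivAt_id (0 : ℂ)).mul ((hasDerivAt_id (0 : ℂ)).sub_const 1)).mul
    (differentiable_completedZeta₀ 0).hasDerivAt).add_const 1)
  have : deriv riemannXi 0 = _ := h.deriv
  rw [this]
  simp

/-- The value is `-(1 + (γ - log (4π)) / 2)`, about `-0.023`, so the claim is the numerical
inequality `γ - log (4π) > -2`. -/
theorem deriv_riemannXi_zero_re_neg : (deriv riemannXi 0).re < 0 := by
  rw [deriv_riemannXi_zero, completedRiemannZeta₀_zero]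
  have hlog : Complex.log (4 * Real.pi) = ((Real.log (4 * Real.pi) : ℝ) : ℂ) := by
    rw [ofReal_log (by positivity)]; push_cast; rfl
  have hre : (-(((Real.eulerMascheroniConstant : ℂ) - Complex.log (4 * Real.pi)) / 2 + 1)).re =
      -((Real.eulerMascheroniConstant - Real.log (4 * Real.pi)) / 2 + 1) := by
    rw [hlog, ← ofReal_sub, ← ofReal_ofNat, ← ofReal_div, ← ofReal_one, ← ofReal_add, ← ofReal_neg,
      ofReal_re]
  rw [hre]
  -- Index `15` gives `γ > H_15 - log 16`, about `0.5456`, enough together with `log π ≤ 1.15`; the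
  -- logarithm is then a multiple of `log 2`.
  have hγ := Real.eulerMascheroniSeq_lt_eulerMascheroniConstant 15
  have hl16 : Real.log ((15 : ℕ) + 1) = 4 * Real.log 2 := by
    rw [show (((15 : ℕ) : ℝ) + 1) = 2 ^ 4 by norm_num, Real.log_pow]; norm_num
  have hpi : Real.log Real.pi ≤ 1.15 := by
    have h1 : Real.pi ≤ Real.exp 1.15 := by
      have h2 : (1.15 : ℝ) = 1 + 0.15 := by norm_num
      have h3 : (1 : ℝ) + 0.15 + 0.15 ^ 2 / 2 ≤ Real.exp 0.15 :=
        Real.quadratic_le_exp_of_nonneg (by norm_num)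
      rw [h2, Real.exp_add]
      nlinarith [Real.exp_one_gt_d9, Real.pi_lt_d4]
    rw [Real.log_le_iff_le_exp Real.pi_pos]
    exact h1
  have hl4 : Real.log (4 * Real.pi) = 2 * Real.log 2 + Real.log Real.pi := by
    rw [Real.log_mul (by norm_num) Real.pi_ne_zero, show (4 : ℝ) = 2 ^ 2 by norm_num, Real.log_pow]
    norm_num
  rw [Real.eulerMascheroniSeq, hl16] at hγ
  have hH : ((harmonic 15 : ℚ) : ℝ) ≥ 3.318 := by
    have : harmonic 15 ≥ 3.318 := by
      simp [harmonic, Finset.sum_range_succ]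
      norm_num
    have h2 := (Rat.cast_le (K := ℝ)).mpr this
    norm_num at h2 ⊢
  rw [hl4]
  linarith [Real.log_two_lt_d9]

/-- Each factor of the classical formula commutes with conjugation. The range `|x| < 1` avoids the
pole of `ζ` and, apart from `0`, those of `Γ(x / 2)`. -/
theorem riemannXi_ofReal_im {x : ℝ} (hx : |x| < 1) : (riemannXi x).im = 0 := by
  rcases eq_or_ne x 0 with rfl | hx0
  · simp [riemannXi_zero]
  have habs := abs_lt.mp hx
  have h1 : (x : ℂ) ≠ 1 := by
    intro h
    have : x = 1 := by exact_mod_cast h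
    linarith
  have hG : ∀ n : ℕ, (x : ℂ) / 2 ≠ -n := by
    intro n h
    have h2 : x / 2 = -n := by exact_mod_cast h
    rcases Nat.eq_zero_or_pos n with rfl | hn
    · apply hx0; simpa using h2
    · have : (1 : ℝ) ≤ n := by exact_mod_cast hn
      linarith
  rw [← conj_eq_iff_im, riemannXi_eq h1 hG]
  have hcpow : (Real.pi : ℂ) ^ (-(x : ℂ) / 2) = ((Real.pi ^ (-x / 2) : ℝ) : ℂ) := by
    rw [ofReal_cpow Real.pi_pos.le]; push_cast; rfl
  rw [hcpow]
  simp only [map_mul, map_sub, map_one, conj_ofReal, ← Gamma_conj, ← riemannZeta_conj, map_div₀,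
    map_ofNat]

/-! ### The coefficients `α_n` for small `n * τ` -/

/-- On the real line, the iterated derivatives of the real part of a holomorphic function are
the real parts of its iterated complex derivatives. -/
theorem iteratedDeriv_eq_re_of_eqOn {f : ℂ → ℂ} {g : ℝ → ℝ} {U : Set ℂ} (hU : IsOpen U)
    (hf : DifferentiableOn ℂ f U) (hg : ∀ x : ℝ, (x : ℂ) ∈ U → g x = (f x).re) (m : ℕ) :
    ∀ x : ℝ, (x : ℂ) ∈ U → iteratedDeriv m g x = (iteratedDeriv m f x).re := by
  induction m with
  | zero => simpa using hg
  | succ m ih =>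
    intro x hx
    have hev : iteratedDeriv m g =ᶠ[nhds x] fun y : ℝ => (iteratedDeriv m f y).re := by
      filter_upwards [(hU.preimage continuous_ofReal).mem_nhds hx] with y hy using ih y hy
    have han : AnalyticAt ℂ (iteratedDeriv m f) x := by
      rw [iteratedDeriv_eq_iterate]
      exact (hf.analyticAt (hU.mem_nhds hx)).iterated_deriv m
    rw [iteratedDeriv_succ, hev.deriv_eq, iteratedDeriv_succ]
    exact han.differentiableAt.hasDerivAt.real_of_complex.deriv

theorem norm_one_add_pow_sub_one_le (w : ℂ) (k : ℕ) :
    ‖(1 + w) ^ k - 1‖ ≤ Real.exp (k * ‖w‖) - 1 := by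
  simpa using Finset.norm_prod_one_add_sub_one_le (Finset.range k) fun _ => w

/-- The `n`-th Taylor coefficient of `s ^ (n - 1) * G s` at `c` is close to that of `G` of
order `1` when `n * c` is small. -/
theorem norm_iteratedDeriv_pow_mul_sub_deriv_le {G : ℂ → ℂ} {c : ℂ} {r M : ℝ} (hr : 0 < r)
    (hG : DifferentiableOn ℂ G (Metric.closedBall c r)) (hM : ∀ z ∈ Metric.sphere c r, ‖G z‖ ≤ M)
    {n : ℕ} (hn : 1 ≤ n) :
    ‖iteratedDeriv n (fun s => s ^ (n - 1) * G s) c / n.factorial - deriv G c‖ ≤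
      (Real.exp (n * (‖c‖ / r)) - 1) * M / r := by
  have hpiI : (2 * Real.pi * I : ℂ) ≠ 0 := two_pi_I_ne_zero
  have h1 := DifferentiableOn.circleIntegral_one_div_sub_center_pow_smul hr n
    (f := fun s => s ^ (n - 1) * G s) (c := c) (by fun_prop)
  have h2 := hG.deriv_eq_smul_circleIntegral hr
  have hne : ∀ z ∈ Metric.sphere c r, z - c ≠ 0 := fun z hz h => by
    have : ‖z - c‖ = r := by simpa [dist_eq_norm] using hz
    rw [h, norm_zero] at this
    exact hr.ne this
  have hGc : ContinuousOn G (Metric.sphere c r) :=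
    hG.continuousOn.mono Metric.sphere_subset_closedBall
  have hinv : ∀ k : ℕ, ContinuousOn (fun z => 1 / (z - c) ^ k) (Metric.sphere c r) := fun k =>
    ContinuousOn.div (by fun_prop) (by fun_prop) fun z hz => pow_ne_zero _ (hne z hz)
  have hpG : ContinuousOn (fun z => z ^ (n - 1) * G z) (Metric.sphere c r) := by fun_prop
  have i1 : CircleIntegrable (fun z => (1 / (z - c) ^ (n + 1)) • (z ^ (n - 1) * G z)) c r :=
    ContinuousOn.circleIntegrable hr.le ((hinv _).smul hpG)
  have i2 : CircleIntegrable (fun z => (1 / (z - c) ^ 2) • G z) c r :=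
    ContinuousOn.circleIntegrable hr.le ((hinv _).smul hGc)
  have hsub := circleIntegral.integral_sub i1 i2
  rw [h1, h2] at hsub
  have hbound : ‖∮ z in C(c, r), (1 / (z - c) ^ (n + 1)) • (z ^ (n - 1) * G z) -
      (1 / (z - c) ^ 2) • G z‖ ≤
        2 * Real.pi * r * ((Real.exp (n * (‖c‖ / r)) - 1) * M / r ^ 2) := by
    refine circleIntegral.norm_integral_le_of_norm_le_const hr.le fun z hz => ?_
    have hz0 := hne z hz
    have hzr : ‖z - c‖ = r := by simpa [dist_eq_norm] using hz
    -- Both coefficients are Cauchy integrals over one circle, and `z / (z - c) = 1 + c / (z - c)`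
    -- shows how little the integrands differ.
    have e : (1 / (z - c) ^ (n + 1)) • (z ^ (n - 1) * G z) - (1 / (z - c) ^ 2) • G z =
        ((1 + c / (z - c)) ^ (n - 1) - 1) * G z / (z - c) ^ 2 := by
      have e1 : 1 + c / (z - c) = z / (z - c) := by field_simp; ring
      obtain ⟨k, rfl⟩ : ∃ k, n = k + 1 := ⟨n - 1, by omega⟩
      rw [e1, div_pow]
      simp only [smul_eq_mul, Nat.add_sub_cancel]
      field_simp
      ring
    rw [e, norm_div, norm_mul, norm_pow, hzr]
    gcongr
    · have : (0 : ℝ) ≤ n * (‖c‖ / r) := by positivity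
      linarith [Real.one_le_exp this]
    · refine (norm_one_add_pow_sub_one_le _ _).trans ?_
      rw [norm_div, hzr]
      gcongr
      exact Nat.sub_le _ _
    · exact hM z hz
  rw [hsub] at hbound
  have e2 : (2 * Real.pi * I / n.factorial : ℂ) • iteratedDeriv n (fun s => s ^ (n - 1) * G s) c -
      (2 * Real.pi * I : ℂ) • deriv G c = (2 * Real.pi * I : ℂ) *
        (iteratedDeriv n (fun s => s ^ (n - 1) * G s) c / n.factorial - deriv G c) := by
    simp only [smul_eq_mul]; ring
  rw [e2, norm_mul] at hbound
  have e3 : ‖(2 * Real.pi * I : ℂ)‖ = 2 * Real.pi := by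
    simp [abs_of_pos Real.pi_pos]
  rw [e3, mul_assoc (2 * Real.pi)] at hbound
  have := le_of_mul_le_mul_left hbound (by positivity)
  refine this.trans (le_of_eq ?_)
  field_simp

/-- The coefficients `α_n(τ)` are negative for `0 ≤ τ < c / n`. -/
theorem exists_forall_liAlpha_neg :
    ∃ c : ℝ, 0 < c ∧ ∀ n : ℕ, 1 ≤ n → ∀ τ : ℝ, 0 ≤ τ → τ < c / n → liAlpha n τ < 0 := by
  have hcont : Continuous riemannXi := differentiable_riemannXi.continuous
  have hev : ∀ᶠ s in nhds (0 : ℂ), riemannXi s ∈ slitPlane := by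
    refine hcont.continuousAt.eventually_mem (isOpen_slitPlane.mem_nhds ?_)
    simp [riemannXi_zero]
  obtain ⟨R₀, hR₀, hball₀⟩ := Metric.eventually_nhds_iff_ball.mp hev
  set R := min R₀ 1
  have hR : 0 < R := by positivity
  have hball : ∀ s ∈ Metric.ball (0 : ℂ) R, riemannXi s ∈ slitPlane := fun s hs =>
    hball₀ s (Metric.ball_subset_ball (min_le_left _ _) hs)
  set G : ℂ → ℂ := fun s => log (riemannXi s)
  have hGd : DifferentiableOn ℂ G (Metric.ball 0 R) := fun s hs =>
    ((differentiable_riemannXi s).clog (hball s hs)).differentiableWithinAt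
  -- For `0 ≤ τ < r` the circle of radius `r` about `τ` stays within `2 * r < R`.
  set r := R / 3
  have hr : 0 < r := by positivity
  have hsub : Metric.closedBall (0 : ℂ) (2 * r) ⊆ Metric.ball 0 R :=
    Metric.closedBall_subset_ball (by simp only [r]; linarith)
  obtain ⟨M, hM⟩ := (isCompact_closedBall (0 : ℂ) (2 * r)).exists_bound_of_continuousOn
    (hGd.continuousOn.mono hsub)
  have hderiv0 : (deriv G 0).re < 0 := by
    have := ((differentiable_riemannXi 0).hasDerivAt.clog (by simp [riemannXi_zero])).deriv
    simp only [G, this, riemannXi_zero, div_one]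
    exact deriv_riemannXi_zero_re_neg
  set d := (deriv G 0).re
  have hG' : ∀ᶠ s in nhds (0 : ℂ), (deriv G s).re < d / 2 := by
    have h1 : ContinuousAt (deriv G) 0 :=
      (hGd.analyticAt (Metric.ball_mem_nhds 0 hR)).deriv.continuousAt
    have h2 : ContinuousAt (fun s => (deriv G s).re) 0 := continuous_re.continuousAt.comp h1
    exact h2.eventually_lt_const (by simp only [d] at *; linarith)
  obtain ⟨ε, hε, hεb⟩ := Metric.eventually_nhds_iff_ball.mp hG'
  have hsmall : ∀ᶠ c in nhds (0 : ℝ), (Real.exp (c / r) - 1) * M / r < -d / 2 := by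
    have h1 : ContinuousAt (fun c => (Real.exp (c / r) - 1) * M / r) 0 := by fun_prop
    exact h1.eventually_lt_const (by simp; linarith)
  obtain ⟨η, hη, hηb⟩ := Metric.eventually_nhds_iff_ball.mp hsmall
  -- For `n * τ` below this, `(log ξ)'(τ)` has real part below `d / 2` and the Cauchy error is below
  -- `-d / 2`.
  refine ⟨min (min r ε) (η / 2), by positivity, fun n hn τ hτ0 hτ => ?_⟩
  have hn1 : (1 : ℝ) ≤ n := by exact_mod_cast hn
  have hnτ : n * τ < min (min r ε) (η / 2) := by
    rwa [lt_div_iff₀ (by linarith), mul_comm] at hτ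
  have hττ : τ ≤ n * τ := le_mul_of_one_le_left hτ0 hn1
  have hτr : τ < r := lt_of_le_of_lt hττ (hnτ.trans_le ((min_le_left _ _).trans (min_le_left _ _)))
  have hτε : τ < ε := lt_of_le_of_lt hττ (hnτ.trans_le ((min_le_left _ _).trans (min_le_right _ _)))
  have hnη : n * τ < η := by linarith [hnτ.trans_le (min_le_right _ _)]
  have hτn : ‖(τ : ℂ)‖ = τ := by simp [abs_of_nonneg hτ0]
  have hcb : Metric.closedBall (τ : ℂ) r ⊆ Metric.closedBall 0 (2 * r) :=
    Metric.closedBall_subset_closedBall' (by simp [abs_of_nonneg hτ0]; linarith)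
  have hmain := norm_iteratedDeriv_pow_mul_sub_deriv_le hr (hGd.mono (hcb.trans hsub)) (M := M)
    (fun z hz => hM z (hcb (Metric.sphere_subset_closedBall hz))) hn
  set X := iteratedDeriv n (fun s => s ^ (n - 1) * G s) (τ : ℂ) with hX
  have hα : liAlpha n τ = 1 / ((n - 1).factorial : ℝ) * X.re := by
    rw [liAlpha, hX]
    congr 1
    refine iteratedDeriv_eq_re_of_eqOn (U := Metric.ball 0 R) Metric.isOpen_ball
      (by fun_prop) (fun x hx => ?_) n τ (hsub (hcb (Metric.mem_closedBall_self hr.le)))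
    have hx1 : |x| < 1 := by
      have : |x| < R := by simpa using hx
      exact this.trans_le (min_le_right _ _)
    have him := riemannXi_ofReal_im hx1
    have hxi : riemannXi x = ((riemannXi x).re : ℂ) := by
      apply Complex.ext <;> simp [him]
    rw [← ofReal_pow, re_ofReal_mul, log_re]
    congr 1
    nth_rw 2 [hxi]
    rw [norm_real, Real.norm_eq_abs, Real.log_abs]
  have hXre : (X / n.factorial).re < 0 := by
    have h1 : (X / n.factorial - deriv G τ).re ≤ (Real.exp (n * (‖(τ : ℂ)‖ / r)) - 1) * M / r :=
      (re_le_norm _).trans hmain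
    have h2 := hεb τ (by simpa [abs_of_nonneg hτ0] using hτε)
    have h3 := hηb (n * τ) (by simpa [abs_of_nonneg hτ0] using hnη)
    rw [hτn, ← mul_div_assoc] at h1
    rw [sub_re] at h1
    linarith
  rw [← ofReal_natCast, div_ofReal_re, div_neg_iff] at hXre
  have hf : (0 : ℝ) < n.factorial := by positivity
  have hXneg : X.re < 0 := by
    rcases hXre with h | h <;> linarith [h.1, h.2]
  rw [hα]
  exact mul_neg_of_pos_of_neg (by positivity) hXneg

/-! ### Zeros of `ξ` and their multiplicities -/

theorem riemannXi_one : riemannXi 1 = 1 := by simp [riemannXi]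

theorem half_ne_neg_natCast_of_re_pos {s : ℂ} (hs : 0 < s.re) (n : ℕ) : s / 2 ≠ -n := by
  intro h
  have h2 := congrArg re h
  simp at h2
  have : (0 : ℝ) ≤ n := n.cast_nonneg
  linarith

theorem riemannXi_ne_zero_of_one_le_re {s : ℂ} (hs : 1 ≤ s.re) : riemannXi s ≠ 0 := by
  rcases eq_or_ne s 1 with rfl | h1
  · simp [riemannXi_one]
  have hre : 0 < s.re := by linarith
  have hG := half_ne_neg_natCast_of_re_pos hre
  rw [riemannXi_eq h1 hG]
  have h0 : s ≠ 0 := by rintro rfl; simp at hre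
  have hpi : (Real.pi : ℂ) ^ (-s / 2) ≠ 0 := by
    simp [cpow_eq_zero_iff, Real.pi_ne_zero]
  exact mul_ne_zero (mul_ne_zero (mul_ne_zero (mul_ne_zero h0 (sub_ne_zero.mpr h1)) hpi)
    (Gamma_ne_zero hG)) (riemannZeta_ne_zero_of_one_le_re hs)

/-- The zeros of `ξ` are the nontrivial zeros of `ζ`. -/
theorem riemannXi_eq_zero_iff {s : ℂ} : riemannXi s = 0 ↔ s ∈ nontrivialZeros := by
  constructor
  · intro h
    have hlt : s.re < 1 := by
      by_contra! hc
      exact riemannXi_ne_zero_of_one_le_re hc h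
    have hpos : 0 < s.re := by
      by_contra! hc
      refine riemannXi_ne_zero_of_one_le_re (s := 1 - s) (by simp; linarith) ?_
      rwa [riemannXi_one_sub]
    have h1 : s ≠ 1 := by rintro rfl; simp at hlt
    have h0 : s ≠ 0 := by rintro rfl; simp at hpos
    have hG := half_ne_neg_natCast_of_re_pos hpos
    rw [riemannXi_eq h1 hG] at h
    have hpi : (Real.pi : ℂ) ^ (-s / 2) ≠ 0 := by
      simp [cpow_eq_zero_iff, Real.pi_ne_zero]
    refine ⟨?_, hpos, hlt⟩
    exact (mul_eq_zero.mp h).resolve_left (mul_ne_zero (mul_ne_zero (mul_ne_zero h0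
      (sub_ne_zero.mpr h1)) hpi) (Gamma_ne_zero hG))
  · rintro ⟨hz, hpos, hlt⟩
    have h1 : s ≠ 1 := by rintro rfl; simp at hlt
    rw [riemannXi_eq h1 (half_ne_neg_natCast_of_re_pos hpos), hz, mul_zero]

theorem nontrivialZeros_nonempty : nontrivialZeros.Nonempty := by
  by_contra hne
  have h0 : ∀ z, riemannXi z ≠ 0 := fun z hz => hne ⟨z, riemannXi_eq_zero_iff.mp hz⟩
  obtain ⟨A, hA, hg⟩ := exists_norm_riemannXi_le
  have h := deriv_eq_zero_of_ne_zero_of_symm differentiable_riemannXi h0 riemannXi_one_sub hA hg 0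
  have := deriv_riemannXi_zero_re_neg
  simp [h] at this

theorem one_sub_mem_nontrivialZeros {s : ℂ} (hs : s ∈ nontrivialZeros) :
    1 - s ∈ nontrivialZeros := by
  rw [← riemannXi_eq_zero_iff, riemannXi_one_sub, riemannXi_eq_zero_iff]
  exact hs

theorem analyticAt_riemannZeta {s : ℂ} (hs : s ≠ 1) : AnalyticAt ℂ riemannZeta s :=
  analyticAt_iff_eventually_differentiableAt.mpr <| by
    filter_upwards [isOpen_ne.mem_nhds hs] with z hz using differentiableAt_riemannZeta hz

/-- In the critical strip `ξ = E * ζ` with `E` analytic and nonzero, so zero counts for `ξ` become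
counts for `ζ`. -/
theorem analyticOrderAt_riemannXi_eq {ρ : ℂ} (hρ : ρ ∈ nontrivialZeros) :
    analyticOrderAt riemannXi ρ = analyticOrderAt riemannZeta ρ := by
  obtain ⟨-, hpos, hlt⟩ := hρ
  set E : ℂ → ℂ := fun s => s * (s - 1) * (Real.pi : ℂ) ^ (-s / 2) * Gamma (s / 2)
  have hU : IsOpen {s : ℂ | 0 < s.re ∧ s.re < 1} :=
    (isOpen_lt continuous_const continuous_re).inter (isOpen_lt continuous_re continuous_const)
  have hUn := hU.mem_nhds (x := ρ) ⟨hpos, hlt⟩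
  have h1 : ρ ≠ 1 := by rintro rfl; simp at hlt
  have h0 : ρ ≠ 0 := by rintro rfl; simp at hpos
  have hpi : (Real.pi : ℂ) ≠ 0 := by simp [Real.pi_ne_zero]
  have hE : AnalyticAt ℂ E ρ := by
    refine analyticAt_iff_eventually_differentiableAt.mpr ?_
    filter_upwards [hUn] with s hs
    have hΓ : DifferentiableAt ℂ (fun s => Gamma (s / 2)) s :=
      (differentiableAt_Gamma _ (half_ne_neg_natCast_of_re_pos hs.1)).comp s
        (by fun_prop : DifferentiableAt ℂ (fun s : ℂ => s / 2) s)
    have hp : DifferentiableAt ℂ (fun s : ℂ => (Real.pi : ℂ) ^ (-s / 2)) s :=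
      DifferentiableAt.const_cpow (by fun_prop) (Or.inl hpi)
    exact ((by fun_prop : DifferentiableAt ℂ (fun s : ℂ => s * (s - 1)) s).mul hp).mul hΓ
  have hEne : E ρ ≠ 0 := by
    have hpi : (Real.pi : ℂ) ^ (-ρ / 2) ≠ 0 := by
      simp [cpow_eq_zero_iff, Real.pi_ne_zero]
    exact mul_ne_zero (mul_ne_zero (mul_ne_zero h0 (sub_ne_zero.mpr h1)) hpi)
      (Gamma_ne_zero (half_ne_neg_natCast_of_re_pos hpos))
  have hev : riemannXi =ᶠ[nhds ρ] E * riemannZeta := by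
    filter_upwards [hUn] with s hs
    have h1 : s ≠ 1 := by rintro rfl; simpa using hs.2
    exact riemannXi_eq h1 (half_ne_neg_natCast_of_re_pos hs.1)
  rw [analyticOrderAt_congr hev, analyticOrderAt_mul hE (analyticAt_riemannZeta h1),
    hE.analyticOrderAt_eq_zero.mpr hEne, zero_add]

theorem analyticOrderAt_riemannXi_ne_top (z : ℂ) : analyticOrderAt riemannXi z ≠ ⊤ := by
  intro h
  have := AnalyticOnNhd.eqOn_zero_of_preconnected_of_eventuallyEq_zero
    (f := riemannXi) (U := Set.univ) (fun z _ => differentiable_riemannXi.analyticAt z)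
    isPreconnected_univ (Set.mem_univ z) (analyticOrderAt_eq_top.mp h) (Set.mem_univ 0)
  simp [riemannXi_zero] at this

theorem analyticOrderNatAt_riemannZeta_pos {ρ : ℂ} (hρ : ρ ∈ nontrivialZeros) :
    0 < analyticOrderNatAt riemannZeta ρ := by
  have htop : analyticOrderAt riemannZeta ρ ≠ ⊤ :=
    analyticOrderAt_riemannXi_eq hρ ▸ analyticOrderAt_riemannXi_ne_top ρ
  have h1 : ρ ≠ 1 := by rintro rfl; simpa using hρ.2.2
  rw [Nat.pos_iff_ne_zero]
  intro h
  have h2 := Nat.cast_analyticOrderNatAt htop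
  rw [h, Nat.cast_zero] at h2
  exact (analyticAt_riemannZeta h1).analyticOrderAt_eq_zero.mp h2.symm hρ.1

theorem summable_multiplicity_div_norm_sq :
    Summable fun ρ : nontrivialZeros => (analyticOrderNatAt riemannZeta ρ : ℝ) / ‖(ρ : ℂ)‖ ^ 2 := by
  obtain ⟨A, hA, hg⟩ := exists_norm_riemannXi_le
  have h := summable_analyticOrderNatAt_div_norm_sq differentiable_riemannXi
    (by simp [riemannXi_zero]) hA hg
  refine (h.subtype nontrivialZeros).congr fun ρ => ?_
  simp only [Function.comp_apply, analyticOrderNatAt, analyticOrderAt_riemannXi_eq ρ.2]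

/-! ### Conjugation symmetry of the zeros -/

open ComplexConjugate

theorem conj_mem_nontrivialZeros {s : ℂ} (hs : s ∈ nontrivialZeros) :
    conj s ∈ nontrivialZeros :=
  ⟨by rw [riemannZeta_conj, hs.1, map_zero], by simpa using hs.2.1, by simpa using hs.2.2⟩

theorem analyticAt_conj_conj {g : ℂ → ℂ} {z : ℂ} (hg : AnalyticAt ℂ g z) :
    AnalyticAt ℂ (fun w => conj (g (conj w))) (conj z) := by
  rw [analyticAt_iff_eventually_differentiableAt] at hg ⊢
  have hc : Filter.Tendsto (fun w : ℂ => conj w) (nhds (conj z)) (nhds z) := by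
    simpa using continuous_conj.tendsto (conj z)
  filter_upwards [hc.eventually hg] with w hw
  simpa [Function.comp_def] using hw.conj_conj

/-- Conjugating the local factorisation `ζ(w) = (w - ρ) ^ m * g(w)` gives one of the same order at
`conj ρ`. -/
theorem analyticOrderNatAt_riemannZeta_conj {ρ : ℂ} (hρ : ρ ∈ nontrivialZeros) :
    analyticOrderNatAt riemannZeta (conj ρ) = analyticOrderNatAt riemannZeta ρ := by
  have htop : ∀ {ρ}, ρ ∈ nontrivialZeros → analyticOrderAt riemannZeta ρ ≠ ⊤ := fun hρ =>
    analyticOrderAt_riemannXi_eq hρ ▸ analyticOrderAt_riemannXi_ne_top _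
  have han : ∀ {ρ}, ρ ∈ nontrivialZeros → AnalyticAt ℂ riemannZeta ρ := fun hρ =>
    analyticAt_riemannZeta (by rintro rfl; simpa using hρ.2.2)
  obtain ⟨g, hg, hg0, hev⟩ := ((han hρ).analyticOrderNatAt_eq_iff (htop hρ)).mp rfl
  have hρ' := conj_mem_nontrivialZeros hρ
  refine ((han hρ').analyticOrderNatAt_eq_iff (htop hρ')).mpr
    ⟨fun w => conj (g (conj w)), analyticAt_conj_conj hg, by simpa using hg0, ?_⟩
  have hc : Filter.Tendsto (fun w : ℂ => conj w) (nhds (conj ρ)) (nhds ρ) := by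
    simpa using continuous_conj.tendsto (conj ρ)
  filter_upwards [hc.eventually hev] with w hw
  rw [riemannZeta_conj] at hw
  have := congrArg conj hw
  simpa using this

/-! ### Expansion and sign of `F` -/

/-- The expansion of a term of the series to first order. -/
theorem norm_liTerm_add_le {x τ : ℝ} {ρ : ℂ} (hτ : 0 < τ) (hx : 1 ≤ x) (h : 4 * (x * τ) ≤ ‖ρ‖) :
    ρ / (ρ - τ) ∈ slitPlane ∧
      ‖liTerm x τ ρ + (x * τ : ℝ) * (1 / ρ)‖ ≤ 15 * (x * τ) ^ 2 * (1 / ‖ρ‖ ^ 2) := by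
  have hτx : τ ≤ x * τ := le_mul_of_one_le_left hτ.le hx
  have hN : 0 < ‖ρ‖ := by nlinarith
  have hρ0 : ρ ≠ 0 := norm_pos_iff.mp hN
  have hτn : ‖(τ : ℂ)‖ = τ := by simp [abs_of_pos hτ]
  have hsubn : ‖ρ‖ / 2 ≤ ‖ρ - τ‖ := by
    have := norm_sub_norm_le ρ τ
    rw [hτn] at this
    linarith
  have hsub0 : ρ - τ ≠ 0 := norm_pos_iff.mp (by linarith)
  set u : ℂ := τ / (ρ - τ) with hu
  have hbase : ρ / (ρ - τ) = 1 + u := by rw [hu]; field_simp; ring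
  set a : ℝ := τ / ‖ρ‖ with ha
  have ha0 : 0 < a := by positivity
  have hun : ‖u‖ ≤ 2 * a := by
    rw [hu, norm_div, hτn, ha]
    calc τ / ‖ρ - τ‖ ≤ τ / (‖ρ‖ / 2) := by gcongr
      _ = _ := by field_simp
  have hxa : 4 * (x * a) ≤ 1 := by
    rw [ha, ← mul_div_assoc, ← mul_div_assoc, div_le_one hN]
    exact h
  have hax : a ≤ x * a := le_mul_of_one_le_left ha0.le hx
  have hu2 : ‖u‖ ≤ 1 / 2 := by linarith
  refine ⟨hbase ▸ mem_slitPlane_of_norm_lt_one (by linarith), ?_⟩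
  have hlog : ‖log (1 + u) - u‖ ≤ ‖u‖ ^ 2 := by
    refine (norm_log_one_add_sub_self_le (by linarith)).trans ?_
    have : (1 - ‖u‖)⁻¹ ≤ 2 := by
      rw [inv_le_comm₀ (by linarith) two_pos]; linarith
    nlinarith [sq_nonneg ‖u‖]
  have h1u : 1 + u ≠ 0 := by rw [← hbase]; exact div_ne_zero hρ0 hsub0
  set w : ℂ := log (1 + u) * x with hw
  have hxn : ‖(x : ℂ)‖ = x := by simp [abs_of_nonneg (by linarith : 0 ≤ x)]
  have hlogn : ‖log (1 + u)‖ ≤ 3 * a := by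
    have h1 : ‖log (1 + u)‖ ≤ ‖log (1 + u) - u‖ + ‖u‖ := by
      simpa using norm_add_le (log (1 + u) - u) u
    nlinarith [norm_nonneg u]
  have hwn : ‖w‖ ≤ 3 * (x * a) := by
    rw [hw, norm_mul, hxn]
    nlinarith
  have hexp : ‖exp w - 1 - w‖ ≤ ‖w‖ ^ 2 := norm_exp_sub_one_sub_id_le (by linarith)
  have hdiff : ‖u - τ / ρ‖ ≤ 2 * a ^ 2 := by
    have : u - τ / ρ = u * (τ / ρ) := by rw [hu]; field_simp; ring
    have hτρ : ‖(τ : ℂ) / ρ‖ = a := by rw [norm_div, hτn]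
    rw [this, norm_mul, hτρ]
    nlinarith
  have hwu : ‖w - x * u‖ ≤ x * (4 * a ^ 2) := by
    have : w - x * u = x * (log (1 + u) - u) := by rw [hw]; ring
    rw [this, norm_mul, hxn]
    gcongr
    refine hlog.trans ?_
    nlinarith [norm_nonneg u]
  -- Three errors: linearising `exp`, linearising `log`, and replacing `τ / (ρ - τ)` by `τ / ρ`.
  -- They contribute `9 + 4 + 2 = 15`.
  have hlt : liTerm x τ ρ + (x * τ : ℝ) * (1 / ρ) =
      -(exp w - 1 - w) - (w - x * u) - x * (u - τ / ρ) := by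
    rw [liTerm, hbase, cpow_def_of_ne_zero h1u, ← hw]
    push_cast
    ring
  rw [hlt]
  have hfin : x * a ^ 2 ≤ (x * a) ^ 2 := by
    rw [mul_pow]; gcongr; nlinarith
  calc _ ≤ ‖exp w - 1 - w‖ + ‖w - x * u‖ + ‖x * (u - τ / ρ)‖ := by
        refine (norm_sub_le _ _).trans (add_le_add_left ((norm_sub_le _ _).trans ?_) _)
        rw [norm_neg]
    _ ≤ (3 * (x * a)) ^ 2 + x * (4 * a ^ 2) + x * (2 * a ^ 2) := by
        rw [norm_mul, hxn]
        gcongr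
        exact hexp.trans (by gcongr)
    _ ≤ 15 * (x * a) ^ 2 := by nlinarith
    _ = _ := by rw [ha]; field_simp

/-- The nontrivial zeros stay away from `0` and from `1`. -/
theorem exists_le_norm_of_mem_nontrivialZeros :
    ∃ δ : ℝ, 0 < δ ∧ ∀ ρ ∈ nontrivialZeros, δ ≤ ‖ρ‖ ∧ δ ≤ ‖1 - ρ‖ := by
  have h0 : riemannXi 0 ≠ 0 := by simp [riemannXi_zero]
  obtain ⟨δ, hδ, hball⟩ := Metric.eventually_nhds_iff.mp
    ((differentiable_riemannXi.continuous.continuousAt (x := 0)).eventually_ne h0)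
  have key : ∀ ρ ∈ nontrivialZeros, δ ≤ ‖ρ‖ := fun ρ hρ => by
    by_contra! hlt
    exact hball (by simpa using hlt) (riemannXi_eq_zero_iff.mpr hρ)
  exact ⟨δ, hδ, fun ρ hρ => ⟨key ρ hρ, key _ (one_sub_mem_nontrivialZeros hρ)⟩⟩

/-- `re (1 / z)` has the sign of `re z`, and `ρ` and `1 - ρ` both lie in the right half-plane. This
decides the sign of `F`. -/
theorem re_one_div_add_one_div_pos {ρ : ℂ} (hρ : ρ ∈ nontrivialZeros) :
    0 < (1 / ρ + 1 / (1 - ρ)).re := by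
  obtain ⟨-, h0, h1⟩ := hρ
  have hn : 0 < normSq ρ := normSq_pos.mpr (by rintro rfl; simp at h0)
  have hn' : 0 < normSq (1 - ρ) := normSq_pos.mpr (by
    intro h
    have := congrArg re h
    simp at this
    linarith)
  rw [one_div, one_div, add_re, inv_re, inv_re]
  have : 0 < (1 - ρ).re := by simpa using h1
  positivity

/-- The permutation of the nontrivial zeros by complex conjugation. -/
def conjNontrivialZeros : nontrivialZeros ≃ nontrivialZeros where
  toFun ρ := ⟨conj (ρ : ℂ), conj_mem_nontrivialZeros ρ.2⟩
  invFun ρ := ⟨conj (ρ : ℂ), conj_mem_nontrivialZeros ρ.2⟩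
  left_inv ρ := by simp
  right_inv ρ := by simp

/-- Principal powers commute with conjugation off the branch cut, hence the `slitPlane` hypothesis.
-/
theorem liTerm_conj {x τ : ℝ} {ρ : ℂ} (h : ρ / (ρ - τ) ∈ slitPlane) :
    liTerm x τ (conj ρ) = conj (liTerm x τ ρ) := by
  have e : conj ρ / (conj ρ - (τ : ℂ)) = conj (ρ / (ρ - τ)) := by
    simp only [map_div₀, map_sub, conj_ofReal]
  rw [liTerm, liTerm, e, conj_cpow _ _ (mem_slitPlane_iff_arg.mp h).1, conj_ofReal, map_sub,
    map_one]

/-- If all the powers are taken off the branch cut, the sum of the series is real. -/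
theorem liSum_eq_ofReal_liF {x τ : ℝ}
    (h : ∀ ρ ∈ nontrivialZeros, ρ / (ρ - τ) ∈ slitPlane) : (liF x τ : ℂ) = liSum x τ := by
  have hterm : ∀ ρ : nontrivialZeros,
      liPairedTerm x τ (conjNontrivialZeros ρ) = conj (liPairedTerm x τ ρ) := by
    intro ρ
    have e : (1 : ℂ) - conj (ρ : ℂ) = conj (1 - (ρ : ℂ)) := by simp
    simp only [liPairedTerm, conjNontrivialZeros, Equiv.coe_fn_mk]
    rw [e, liTerm_conj (h _ ρ.2), liTerm_conj (h _ (one_sub_mem_nontrivialZeros ρ.2)),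
      analyticOrderNatAt_riemannZeta_conj ρ.2, map_mul, map_add, conj_natCast]
  have hreal : conj (∑' ρ, liPairedTerm x τ ρ) = ∑' ρ, liPairedTerm x τ ρ := by
    rw [conj_tsum, ← conjNontrivialZeros.tsum_eq (liPairedTerm x τ)]
    exact tsum_congr fun ρ => (hterm ρ).symm
  rw [liF, ← conj_eq_iff_re, liSum, map_mul, map_mul, hreal]
  simp only [map_div₀, map_one, conj_ofReal, map_ofNat]

/-- The series of the function `F` converges and has a negative sum if `x > 1` and if `x * τ` is
positive and small. -/
theorem exists_forall_liF_neg :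
    ∃ τ₀ : ℝ, 0 < τ₀ ∧ ∀ x τ : ℝ, 1 ≤ x → 0 < τ → x * τ < τ₀ →
      Summable (liPairedTerm x τ) ∧ (liF x τ : ℂ) = liSum x τ ∧ liF x τ < 0 := by
  obtain ⟨δ, hδ, hzero⟩ := exists_le_norm_of_mem_nontrivialZeros
  let m : nontrivialZeros → ℝ := fun ρ => analyticOrderNatAt riemannZeta ρ
  let P : nontrivialZeros → ℂ := fun ρ => (m ρ : ℂ) * (1 / (ρ : ℂ) + 1 / (1 - (ρ : ℂ)))
  have hT := summable_multiplicity_div_norm_sq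
  set T := ∑' ρ : nontrivialZeros, m ρ / ‖(ρ : ℂ)‖ ^ 2
  have hT0 : 0 ≤ T := tsum_nonneg fun ρ => by positivity
  set k : ℝ := 1 + 1 / δ
  have hk : 0 < k := by positivity
  have hinv : ∀ ρ : nontrivialZeros, 1 / ‖1 - (ρ : ℂ)‖ ≤ k * (1 / ‖(ρ : ℂ)‖) := by
    intro ρ
    obtain ⟨h0, h1⟩ := hzero ρ ρ.2
    have hle : ‖(ρ : ℂ)‖ ≤ k * ‖1 - (ρ : ℂ)‖ := by
      have h2 : ‖(ρ : ℂ)‖ ≤ 1 + ‖1 - (ρ : ℂ)‖ := by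
        have := norm_sub_le (1 : ℂ) (1 - ρ)
        rwa [norm_one, sub_sub_cancel] at this
      have h3 : 1 ≤ 1 / δ * ‖1 - (ρ : ℂ)‖ := by
        rw [one_div, inv_mul_eq_div, one_le_div hδ]; exact h1
      simp only [k]
      linarith
    rw [mul_one_div, div_le_div_iff₀ (by linarith) (by linarith), one_mul]
    exact hle
  have hPs : Summable P := by
    refine Summable.of_norm_bounded (hT.mul_left k) fun ρ => ?_
    have h0 : (ρ : ℂ) ≠ 0 := norm_pos_iff.mp (hδ.trans_le (hzero ρ ρ.2).1)
    have h1 : 1 - (ρ : ℂ) ≠ 0 := norm_pos_iff.mp (hδ.trans_le (hzero ρ ρ.2).2)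
    -- Pairing improves the decay from `1 / ‖ρ‖` to `1 / ‖ρ‖ ^ 2`, which gives absolute convergence.
    have e : 1 / (ρ : ℂ) + 1 / (1 - (ρ : ℂ)) = 1 / (ρ : ℂ) * (1 / (1 - (ρ : ℂ))) := by
      field_simp; ring
    simp only [P, m]
    rw [e, norm_mul, norm_mul, norm_div, norm_div, norm_one, ofReal_natCast, Complex.norm_natCast]
    calc _ ≤ (analyticOrderNatAt riemannZeta ρ : ℝ) * (1 / ‖(ρ : ℂ)‖ * (k * (1 / ‖(ρ : ℂ)‖))) := by
          gcongr; exact hinv ρ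
      _ = _ := by ring
  set S := (∑' ρ, P ρ).re with hS
  have hSpos : 0 < S := by
    have hre : ∀ ρ, 0 < (P ρ).re := fun ρ => by
      simp only [P]
      rw [re_ofReal_mul]
      exact mul_pos (Nat.cast_pos.mpr (analyticOrderNatAt_riemannZeta_pos ρ.2))
        (re_one_div_add_one_div_pos ρ.2)
    obtain ⟨ρ₀, hρ₀⟩ := nontrivialZeros_nonempty
    rw [hS, re_tsum hPs]
    exact (hasSum_re hPs.hasSum).summable.tsum_pos (fun ρ => (hre ρ).le) ⟨ρ₀, hρ₀⟩ (hre _)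
  set K : ℝ := 15 * (1 + k ^ 2)
  have hK : 0 < K := by positivity
  -- `δ / 4` makes the expansion valid at every zero; the second bound makes the error `K * y ^ 2 *
  -- T` smaller than the main term `y * S`, the `+ 1` keeping the denominator positive.
  refine ⟨min (δ / 4) (S / (K * T + 1)), by positivity, fun x τ hx hτ hxτ => ?_⟩
  have hy0 : 0 < x * τ := by positivity
  set y := x * τ with hy
  have hyδ : 4 * y ≤ δ := by linarith [hxτ.trans_le (min_le_left _ _)]
  have hyS : y * (K * T + 1) < S := by
    have := hxτ.trans_le (min_le_right _ _)
    rwa [lt_div_iff₀ (by positivity)] at this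
  have hexp : ∀ ρ ∈ nontrivialZeros, ρ / (ρ - τ) ∈ slitPlane ∧
      ‖liTerm x τ ρ + (y : ℝ) * (1 / ρ)‖ ≤ 15 * y ^ 2 * (1 / ‖ρ‖ ^ 2) := fun ρ hρ =>
    norm_liTerm_add_le hτ hx (hyδ.trans (hzero ρ hρ).1)
  have hbound : ∀ ρ : nontrivialZeros, ‖liPairedTerm x τ ρ + y * P ρ‖ ≤
      K * y ^ 2 * (m ρ / ‖(ρ : ℂ)‖ ^ 2) := by
    intro ρ
    have h1 := (hexp ρ ρ.2).2
    have h2 := (hexp _ (one_sub_mem_nontrivialZeros ρ.2)).2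
    have h3 : 1 / ‖1 - (ρ : ℂ)‖ ^ 2 ≤ k ^ 2 * (1 / ‖(ρ : ℂ)‖ ^ 2) := by
      calc 1 / ‖1 - (ρ : ℂ)‖ ^ 2 = (1 / ‖1 - (ρ : ℂ)‖) ^ 2 := by rw [one_div_pow]
        _ ≤ (k * (1 / ‖(ρ : ℂ)‖)) ^ 2 := by gcongr; exact hinv ρ
        _ = _ := by rw [mul_pow, one_div_pow]
    have e : liPairedTerm x τ ρ + y * P ρ = (analyticOrderNatAt riemannZeta ρ : ℂ) *
        ((liTerm x τ ρ + y * (1 / (ρ : ℂ))) +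
          (liTerm x τ (1 - ρ) + y * (1 / (1 - (ρ : ℂ))))) := by
      simp only [liPairedTerm, P, m, ofReal_natCast]
      ring
    rw [e, norm_mul, Complex.norm_natCast]
    calc _ ≤ m ρ * (15 * y ^ 2 * (1 / ‖(ρ : ℂ)‖ ^ 2) +
          15 * y ^ 2 * (k ^ 2 * (1 / ‖(ρ : ℂ)‖ ^ 2))) := by
          simp only [m]
          gcongr
          refine (norm_add_le _ _).trans (add_le_add h1 (h2.trans ?_))
          gcongr
      _ = _ := by simp only [K]; ring
  have hdiff : Summable fun ρ => liPairedTerm x τ ρ + y * P ρ :=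
    Summable.of_norm_bounded (hT.mul_left _) hbound
  have hsum : Summable (liPairedTerm x τ) := by
    refine (hdiff.sub (hPs.mul_left (y : ℂ))).congr fun ρ => by ring
  have hF := liSum_eq_ofReal_liF (x := x) fun ρ hρ => (hexp ρ hρ).1
  refine ⟨hsum, hF, ?_⟩
  have hnorm : ‖∑' ρ, (liPairedTerm x τ ρ + y * P ρ)‖ ≤ K * y ^ 2 * T :=
    tsum_of_norm_bounded (hT.hasSum.mul_left _) hbound
  rw [hsum.tsum_add (hPs.mul_left (y : ℂ)), tsum_mul_left] at hnorm
  have hre := (re_le_norm _).trans hnorm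
  rw [add_re, re_ofReal_mul, ← hS] at hre
  have hneg : (∑' ρ, liPairedTerm x τ ρ).re < 0 := by
    nlinarith
  have hF' : liF x τ = 1 / τ * (1 / 2 * (∑' ρ, liPairedTerm x τ ρ).re) := by
    rw [liF, liSum, ← ofReal_one, ← ofReal_div, re_ofReal_mul, ← ofReal_ofNat, ← ofReal_div,
      re_ofReal_mul]
  rw [hF']
  exact mul_neg_of_pos_of_neg (by positivity) (by linarith)

theorem theorem5p5 :
    (∃ τ₀ x₀ : ℝ, 0 < τ₀ ∧ 0 < x₀ ∧
      ∀ x τ : ℝ, x₀ < x → x < τ₀ / τ →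
        Summable (liPairedTerm x τ) ∧ (liF x τ : ℂ) = liSum x τ ∧ liF x τ < 0) ∧
    (∃ c : ℝ, 0 < c ∧
      ∀ n : ℕ, 1 ≤ n → ∀ a : ℝ, IsFirstZeroLiAlpha n a → c / (n : ℝ) ≤ a) := by
  constructor
  · obtain ⟨τ₀, hτ₀, h⟩ := exists_forall_liF_neg
    refine ⟨τ₀, 1, hτ₀, one_pos, fun x τ hx hxτ => ?_⟩
    -- For `τ ≤ 0`, including `τ = 0` where `τ₀ / 0 = 0`, the upper bound on `x` would be
    -- nonpositive.
    have hτ : 0 < τ := by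
      by_contra! hτ
      linarith [div_nonpos_of_nonneg_of_nonpos hτ₀.le hτ]
    exact h x τ hx.le hτ ((lt_div_iff₀ hτ).mp hxτ)
  · obtain ⟨c, hc, h⟩ := exists_forall_liAlpha_neg
    refine ⟨c, hc, fun n hn a ha => ?_⟩
    by_contra! hlt
    exact (h n hn a ha.1 hlt).ne ha.2.1
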